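/- Let $A=A_0\oplus A_1$ be a $\mathbb Z/2$-graded supercommutative algebra over a field of characteristic $0$ (the Grassmann-valued functions of $x$ and of all further even and odd variables and parameters) with an even derivation $\partial_x$. Superfields are the expressions $f=f_0+\theta f_1$ with $f_0,f_1\in A$, where $\theta$ is an odd coordinate ($\theta^2=0$, and $\theta$ commutes with $A_0$ and anticommutes with $A_1$); $f$ is bosonic if $f_0\in A_0$, $f_1\in A_1$, and fermionic if $f_0\in A_1$, $f_1\in A_0$. Extend $\partial_x$ to superfields by $\partial_x(f_0+\theta f_1)=\partial_xf_0+\theta\,\partial_xf_1$, and let $\mathcal D=\frac{\partial}{\partial\theta}+\theta\,\partial_x$, i.e. $\mathcal D(f_0+\theta f_1)=f_1+\theta\,\partial_x f_0$. For bosonic $b_0,\dots,b_{k-1}$ and fermionic $o_0,\dots,o_{l-1}$ put $P=(\partial_x^{i}b_j)_{0\le i,j<k}$, $Q=(\partial_x^{i}o_j)_{0\le i<k,\,0\le j<l}$, $R=(\partial_x^{i}\mathcal D b_j)_{0\le i<l,\,0\le j<k}$, $S=(\partial_x^{i}\mathcal D o_j)_{0\le i,j<l}$ and $$\mathrm{Ber}_{(k,l)}[b_0,\dots,b_{k-1};o_0,\dots,o_{l-1}]=\mathrm{Ber}\begin{pmatrix}P&Q\\R&S\end{pmatrix}=\det(P-QS^{-1}R)\,(\det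 S)^{-1},$$ which is defined when $S$ is invertible. Its inverse is $\det(S-RP^{-1}Q)(\det P)^{-1}$ when $P$ is invertible as well; this last expression is taken as the meaning of $\mathrm{Ber}_{(k,l)}^{-1}$ also when only $P$ is invertible. Let $\varphi_0,\varphi_1,\varphi_2,\dots$ be bosonic and $\varphi_{1/2},\varphi_{3/2},\dots$ fermionic superfields. Define recursively, for $j=0,1,2,\dots$, $$\varphi^{(j)}_{j/2}=\mathcal T^{(j-1)}\mathcal T^{(j-2)}\cdots\mathcal T^{(0)}(\varphi_{j/2}),\qquad \mathcal T^{(j)}=\varphi^{(j)}_{j/2}\,\mathcal D\,\bigl(\varphi^{(j)}_{j/2}\bigr)^{-1},$$ as long as the superfields $\varphi^{(j)}_{j/2}$ are invertible. Let $n\ge 0$. (a) If $\varphi^{(j)}_{j/2}$ is invertible for all $0\le j<2n$, then for every bosonic superfield $\Phi$ the Berezinians below are defined, $\mathrm{Ber}_{(n,n)}$ is invertible, and $$\mathcal T^{(2n-1)}\cdots\mathcal T^{(1)}\mathcal T^{(0)}(\Phi)=\bigl(\mathrm{Ber}_{(n,n)}[\varphi_0,\dots,\varphi_{n-1};\varphi_{1/2},\dots,\varphi_{n-1/2}]\bigr)^{-1}\,\mathrm{Ber}_{(n+1,n)}[\varphi_0,\dots,\varphi_{n-1},\Phi;\varphi_{1/2},\dots,\varphi_{n-1/2}].$$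 (b) If $\varphi^{(j)}_{j/2}$ is invertible for all $0\le j\le 2n$, then for every fermionic superfield $F$ the first factor below is defined and invertible, the upper left block $P$ of the second one is invertible, and $$\mathcal T^{(2n)}\cdots\mathcal T^{(1)}\mathcal T^{(0)}(F)=\mathrm{Ber}_{(n+1,n)}[\varphi_0,\dots,\varphi_{n};\varphi_{1/2},\dots,\varphi_{n-1/2}]\,\bigl(\mathrm{Ber}_{(n+1,n+1)}[\varphi_0,\dots,\varphi_{n};\varphi_{1/2},\dots,\varphi_{n-1/2},F]\bigr)^{-1}.$$ In particular, whenever $\mathrm{Ber}_{(n+1,n+1)}[\varphi_0,\dots,\varphi_{n};\varphi_{1/2},\dots,\varphi_{n-1/2},F]$ itself is defined, it is invertible and the formula holds with its inverse in the ordinary sense. -/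

import Mathlib

/-- A `ℤ/2`-graded algebra is supercommutative: `a b = (-1)^{|a||b|} b a` for homogeneous
elements `a`, `b`. -/
class IsSupercommutative {𝕜 A : Type*} [Field 𝕜] [Ring A] [Algebra 𝕜 A]
    (𝒜 : ZMod 2 → Submodule 𝕜 A) : Prop where
  comm : ∀ (i j : ZMod 2) (a b : A), a ∈ 𝒜 i → b ∈ 𝒜 j →
    a * b = (-1) ^ (i.val * j.val) * (b * a)

/-- An even (parity preserving) `𝕜`-linear derivation of a `ℤ/2`-graded algebra. -/
structure EvenDerivation {𝕜 A : Type*} [Field 𝕜] [Ring A] [Algebra 𝕜 A]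
    (𝒜 : ZMod 2 → Submodule 𝕜 A) where
  toLinearMap : A →ₗ[𝕜] A
  leibniz : ∀ a b : A, toLinearMap (a * b) = toLinearMap a * b + a * toLinearMap b
  map_mem : ∀ (i : ZMod 2) (a : A), a ∈ 𝒜 i → toLinearMap a ∈ 𝒜 i

/-- The superfields `f(x, θ) = f₀(x) + θ f₁(x)`, where the components `f₀`, `f₁` belong to the
(graded) algebra `A` of Grassmann-valued functions of all the variables other than `θ`. -/
@[ext]
structure Superfield {𝕜 A : Type*} [Field 𝕜] [Ring A] [Algebra 𝕜 A]
    (𝒜 : ZMod 2 → Submodule 𝕜 A) where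
  /-- the component `f₀` in `f = f₀ + θ f₁` -/
  lower : A
  /-- the component `f₁` in `f = f₀ + θ f₁` -/
  upper : A

namespace Superfield

section Algebra

variable {𝕜 A : Type*} [Field 𝕜] [Ring A] [Algebra 𝕜 A]

section Additive

variable {𝒜 : ZMod 2 → Submodule 𝕜 A}

instance : Zero (Superfield 𝒜) := ⟨⟨0, 0⟩⟩
instance : One (Superfield 𝒜) := ⟨⟨1, 0⟩⟩
instance : Add (Superfield 𝒜) := ⟨fun f g => ⟨f.lower + g.lower, f.upper + g.upper⟩⟩
instance : Neg (Superfield 𝒜) := ⟨fun f => ⟨-f.lower, -f.upper⟩⟩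

@[simp] theorem zero_lower : (0 : Superfield 𝒜).lower = 0 := rfl
@[simp] theorem zero_upper : (0 : Superfield 𝒜).upper = 0 := rfl
@[simp] theorem one_lower : (1 : Superfield 𝒜).lower = 1 := rfl
@[simp] theorem one_upper : (1 : Superfield 𝒜).upper = 0 := rfl
@[simp] theorem add_lower (f g : Superfield 𝒜) : (f + g).lower = f.lower + g.lower := rfl
@[simp] theorem add_upper (f g : Superfield 𝒜) : (f + g).upper = f.upper + g.upper := rfl
@[simp] theorem neg_lower (f : Superfield 𝒜) : (-f).lower = -f.lower := rfl
@[simp] theorem neg_upper (f : Superfield 𝒜) : (-f).upper = -f.upper := rfl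

end Additive

variable (𝒜 : ZMod 2 → Submodule 𝕜 A) [GradedAlgebra 𝒜]

/-- The parity involution `a₀ + a₁ ↦ a₀ - a₁` of the coefficient algebra; it governs the
commutation of coefficients with the odd coordinate: `a θ = θ (parity a)`. -/
def parity (a : A) : A :=
  (DirectSum.decompose 𝒜 a 0 : A) - (DirectSum.decompose 𝒜 a 1 : A)

theorem zmod_two_ne : (0 : ZMod 2) ≠ 1 := by decide

theorem parity_even {a : A} (h : a ∈ 𝒜 0) : parity 𝒜 a = a := by
  simp [parity, DirectSum.decompose_of_mem_same 𝒜 h,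
    DirectSum.decompose_of_mem_ne 𝒜 h zmod_two_ne]

theorem parity_odd {a : A} (h : a ∈ 𝒜 1) : parity 𝒜 a = -a := by
  simp [parity, DirectSum.decompose_of_mem_same 𝒜 h,
    DirectSum.decompose_of_mem_ne 𝒜 h zmod_two_ne.symm]

theorem parity_add (a b : A) : parity 𝒜 (a + b) = parity 𝒜 a + parity 𝒜 b := by
  simp only [parity, DirectSum.decompose_add, DirectSum.add_apply, Submodule.coe_add]
  abel

theorem parity_zero : parity 𝒜 (0 : A) = 0 := parity_even 𝒜 (Submodule.zero_mem _)

theorem parity_one : parity 𝒜 (1 : A) = 1 := parity_even 𝒜 SetLike.GradedOne.one_mem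

theorem exists_even_add_odd (a : A) : ∃ b ∈ 𝒜 0, ∃ c ∈ 𝒜 1, a = b + c := by
  refine ⟨DirectSum.decompose 𝒜 a 0, SetLike.coe_mem _, DirectSum.decompose 𝒜 a 1,
    SetLike.coe_mem _, ?_⟩
  have h : ∀ x : DirectSum (ZMod 2) fun i => 𝒜 i,
      DirectSum.coeAddMonoidHom 𝒜 x = (x 0 : A) + (x 1 : A) := by
    intro x
    induction x using DirectSum.induction_on with
    | zero => simp
    | of i y =>
      obtain rfl | rfl : i = 0 ∨ i = 1 := (by decide : ∀ i : ZMod 2, i = 0 ∨ i = 1) i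
      · rw [DirectSum.coeAddMonoidHom_of, DirectSum.of_eq_same,
          DirectSum.of_eq_of_ne _ _ _ zmod_two_ne.symm]
        simp
      · rw [DirectSum.coeAddMonoidHom_of, DirectSum.of_eq_same,
          DirectSum.of_eq_of_ne _ _ _ zmod_two_ne]
        simp
    | add x y hx hy =>
      rw [map_add, hx, hy]
      simp only [DirectSum.add_apply, Submodule.coe_add]
      abel
  rw [← h]
  exact ((DirectSum.decompose 𝒜).symm_apply_apply a).symm

theorem mul_mem' {i j l : ZMod 2} {a b : A} (ha : a ∈ 𝒜 i) (hb : b ∈ 𝒜 j) (h : i + j = l) :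
    a * b ∈ 𝒜 l :=
  h ▸ SetLike.GradedMul.mul_mem ha hb

theorem parity_mul (a b : A) : parity 𝒜 (a * b) = parity 𝒜 a * parity 𝒜 b := by
  obtain ⟨a₀, ha₀, a₁, ha₁, rfl⟩ := exists_even_add_odd 𝒜 a
  obtain ⟨b₀, hb₀, b₁, hb₁, rfl⟩ := exists_even_add_odd 𝒜 b
  simp only [add_mul, mul_add, parity_add]
  rw [parity_even 𝒜 ha₀, parity_odd 𝒜 ha₁, parity_even 𝒜 hb₀, parity_odd 𝒜 hb₁,
    parity_even 𝒜 (mul_mem' 𝒜 ha₀ hb₀ (by decide)),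
    parity_odd 𝒜 (mul_mem' 𝒜 ha₁ hb₀ (by decide)),
    parity_odd 𝒜 (mul_mem' 𝒜 ha₀ hb₁ (by decide)),
    parity_even 𝒜 (mul_mem' 𝒜 ha₁ hb₁ (by decide))]
  noncomm_ring

variable {𝒜}

/-- `(f₀ + θ f₁)(g₀ + θ g₁) = f₀ g₀ + θ (f₁ g₀ + (parity f₀) g₁)`. -/
instance : Mul (Superfield 𝒜) :=
  ⟨fun f g => ⟨f.lower * g.lower, f.upper * g.lower + parity 𝒜 f.lower * g.upper⟩⟩

@[simp] theorem mul_lower (f g : Superfield 𝒜) : (f * g).lower = f.lower * g.lower := rfl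
@[simp] theorem mul_upper (f g : Superfield 𝒜) :
    (f * g).upper = f.upper * g.lower + parity 𝒜 f.lower * g.upper := rfl

instance : Ring (Superfield 𝒜) where
  add_assoc f g h := by ext <;> simp [add_assoc]
  zero_add f := by ext <;> simp
  add_zero f := by ext <;> simp
  add_comm f g := by ext <;> simp [add_comm]
  neg_add_cancel f := by ext <;> simp
  nsmul := nsmulRec
  zsmul := zsmulRec
  mul_assoc f g h := by ext <;> simp [mul_assoc, parity_mul, add_mul, mul_add, add_assoc]
  one_mul f := by ext <;> simp [parity_one]
  mul_one f := by ext <;> simp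
  zero_mul f := by ext <;> simp [parity_zero]
  mul_zero f := by ext <;> simp
  left_distrib f g h := by
    ext
    · simp [mul_add]
    · simp only [mul_upper, add_lower, add_upper, mul_add]; abel
  right_distrib f g h := by
    ext
    · simp [add_mul]
    · simp only [mul_upper, add_lower, add_upper, add_mul, parity_add]; abel

variable (𝒜)

/-- The bosonic superfields: `f₀` even, `f₁` odd. -/
def bosonic : Subring (Superfield 𝒜) where
  carrier := {f | f.lower ∈ 𝒜 0 ∧ f.upper ∈ 𝒜 1}
  zero_mem' := ⟨Submodule.zero_mem _, Submodule.zero_mem _⟩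
  one_mem' := ⟨SetLike.GradedOne.one_mem, Submodule.zero_mem _⟩
  add_mem' hf hg := ⟨Submodule.add_mem _ hf.1 hg.1, Submodule.add_mem _ hf.2 hg.2⟩
  neg_mem' hf := ⟨Submodule.neg_mem _ hf.1, Submodule.neg_mem _ hf.2⟩
  mul_mem' {f g} hf hg := by
    refine ⟨mul_mem' 𝒜 hf.1 hg.1 (by decide), ?_⟩
    rw [mul_upper, parity_even 𝒜 hf.1]
    exact Submodule.add_mem _ (mul_mem' 𝒜 hf.2 hg.1 (by decide))
      (mul_mem' 𝒜 hf.1 hg.2 (by decide))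

/-- The fermionic superfields: `f₀` odd, `f₁` even. -/
def fermionic : AddSubgroup (Superfield 𝒜) where
  carrier := {f | f.lower ∈ 𝒜 1 ∧ f.upper ∈ 𝒜 0}
  zero_mem' := ⟨Submodule.zero_mem _, Submodule.zero_mem _⟩
  add_mem' hf hg := ⟨Submodule.add_mem _ hf.1 hg.1, Submodule.add_mem _ hf.2 hg.2⟩
  neg_mem' hf := ⟨Submodule.neg_mem _ hf.1, Submodule.neg_mem _ hf.2⟩

variable {𝒜}

theorem fermionic_mul_bosonic {f g : Superfield 𝒜} (hf : f ∈ fermionic 𝒜)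
    (hg : g ∈ bosonic 𝒜) : f * g ∈ fermionic 𝒜 := by
  refine ⟨mul_mem' 𝒜 hf.1 hg.1 (by decide), ?_⟩
  rw [mul_upper, parity_odd 𝒜 hf.1]
  refine Submodule.add_mem _ (mul_mem' 𝒜 hf.2 hg.1 (by decide)) ?_
  exact mul_mem' 𝒜 (Submodule.neg_mem _ hf.1) hg.2 (by decide)

theorem fermionic_mul_fermionic {f g : Superfield 𝒜} (hf : f ∈ fermionic 𝒜)
    (hg : g ∈ fermionic 𝒜) : f * g ∈ bosonic 𝒜 := by
  refine ⟨mul_mem' 𝒜 hf.1 hg.1 (by decide), ?_⟩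
  rw [mul_upper, parity_odd 𝒜 hf.1]
  refine Submodule.add_mem _ (mul_mem' 𝒜 hf.2 hg.1 (by decide)) ?_
  exact mul_mem' 𝒜 (Submodule.neg_mem _ hf.1) hg.2 (by decide)

/-- Bosonic superfields commute with each other. -/
instance [IsSupercommutative 𝒜] : CommRing (bosonic 𝒜) :=
  { (inferInstance : Ring (bosonic 𝒜)) with
    mul_comm := by
      have key : ∀ (j : ZMod 2) (a b : A), a ∈ 𝒜 0 → b ∈ 𝒜 j → a * b = b * a := by
        intro j a b ha hb
        simpa using IsSupercommutative.comm 0 j a b ha hb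
      rintro ⟨f, hf⟩ ⟨g, hg⟩
      apply Subtype.ext
      ext
      · exact key 0 _ _ hf.1 hg.1
      · change f.upper * g.lower + parity 𝒜 f.lower * g.upper
          = g.upper * f.lower + parity 𝒜 g.lower * f.upper
        rw [parity_even 𝒜 hf.1, parity_even 𝒜 hg.1, ← key 1 _ _ hg.1 hf.2,
          key 1 _ _ hf.1 hg.2, add_comm] }

end Algebra

section Operators

variable {𝕜 A : Type*} [Field 𝕜] [Ring A] [Algebra 𝕜 A]
variable {𝒜 : ZMod 2 → Submodule 𝕜 A} [GradedAlgebra 𝒜] (δ : EvenDerivation 𝒜)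

variable (𝒜) in
/-- The odd coordinate `θ`. -/
def theta : Superfield 𝒜 := ⟨0, 1⟩

/-- `∂/∂θ (f₀ + θ f₁) = f₁`. -/
def dTheta (f : Superfield 𝒜) : Superfield 𝒜 := ⟨f.upper, 0⟩

/-- `∂/∂x`, acting on the components by the derivation `δ` of the coefficient functions. -/
def dx (f : Superfield 𝒜) : Superfield 𝒜 := ⟨δ.toLinearMap f.lower, δ.toLinearMap f.upper⟩

/-- The superderivative `𝒟 = ∂/∂θ + θ ∂/∂x`. -/
def superD (f : Superfield 𝒜) : Superfield 𝒜 := dTheta f + theta 𝒜 * dx δ f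

/-- The operator `𝒯 = χ 𝒟 χ⁻¹` (used for invertible `χ`). -/
noncomputable def gauge (χ f : Superfield 𝒜) : Superfield 𝒜 :=
  χ * superD δ (Ring.inverse χ * f)

/-- `iterGauge δ φ j` is the operator `𝒯^{(j-1)} ⋯ 𝒯^{(1)} 𝒯^{(0)}`, where
`𝒯^{(j)} = χ_j 𝒟 χ_j⁻¹` with `χ_j = 𝒯^{(j-1)} ⋯ 𝒯^{(0)} (φ j)`.
Here `φ j` stands for `φ_{j/2}`. -/
noncomputable def iterGauge (φ : ℕ → Superfield 𝒜) : ℕ → Superfield 𝒜 → Superfield 𝒜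
  | 0, f => f
  | j + 1, f => gauge δ (iterGauge φ j (φ j)) (iterGauge φ j f)

/-- The sequence `φ_0, φ_{1/2}, φ_1, φ_{3/2}, …` with bosonic members `b k = φ_k` and
fermionic members `o k = φ_{k + 1/2}`. -/
def interlace (b : ℕ → bosonic 𝒜) (o : ℕ → fermionic 𝒜) (j : ℕ) : Superfield 𝒜 :=
  if Even j then (b (j / 2) : Superfield 𝒜) else (o (j / 2) : Superfield 𝒜)

theorem superD_lower (f : Superfield 𝒜) : (superD δ f).lower = f.upper := by
  simp [superD, dTheta, theta]

theorem superD_upper (f : Superfield 𝒜) :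
    (superD δ f).upper = δ.toLinearMap f.lower := by
  simp [superD, dTheta, theta, dx, parity_zero]

/-- `∂/∂x` on bosonic superfields. -/
def dxB (f : bosonic 𝒜) : bosonic 𝒜 :=
  ⟨dx δ f, δ.map_mem _ _ f.2.1, δ.map_mem _ _ f.2.2⟩

/-- `∂/∂x` on fermionic superfields. -/
def dxF (f : fermionic 𝒜) : fermionic 𝒜 :=
  ⟨dx δ f, δ.map_mem _ _ f.2.1, δ.map_mem _ _ f.2.2⟩

/-- `𝒟` maps bosonic superfields to fermionic ones. -/
def superDB (f : bosonic 𝒜) : fermionic 𝒜 :=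
  ⟨superD δ f, by rw [superD_lower]; exact f.2.2,
    by rw [superD_upper]; exact δ.map_mem _ _ f.2.1⟩

/-- `𝒟` maps fermionic superfields to bosonic ones. -/
def superDF (f : fermionic 𝒜) : bosonic 𝒜 :=
  ⟨superD δ f, by rw [superD_lower]; exact f.2.2,
    by rw [superD_upper]; exact δ.map_mem _ _ f.2.1⟩

/-- The list `f_0, …, f_{n-1}`. -/
def firstN {E : Type*} (f : ℕ → E) (n : ℕ) : Fin n → E := fun i => f i

/-- The list `f_0, …, f_{n-1}, x`. -/
def firstNSnoc {E : Type*} (f : ℕ → E) (n : ℕ) (x : E) : Fin (n + 1) → E :=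
  Fin.snoc (firstN f n) x

/-- The rectangular Wronskian matrix `(∂^i f_j)` with `k` rows and `l` columns, with respect to
a given derivative `∂`. -/
def wronskianMatrix {E : Type*} (d : E → E) (k : ℕ) {l : ℕ} (f : Fin l → E) :
    Matrix (Fin k) (Fin l) E :=
  Matrix.of fun i j => d^[(i : ℕ)] (f j)

/-- The bosonic matrix `P - Q X R`, with `P`, `X` bosonic and `Q`, `R` fermionic matrices. -/
def schur {k l : ℕ} (P : Matrix (Fin k) (Fin k) (bosonic 𝒜))
    (Q : Matrix (Fin k) (Fin l) (fermionic 𝒜)) (X : Matrix (Fin l) (Fin l) (bosonic 𝒜))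
    (R : Matrix (Fin l) (Fin k) (fermionic 𝒜)) : Matrix (Fin k) (Fin k) (bosonic 𝒜) :=
  Matrix.of fun i j =>
    ⟨(P i j : Superfield 𝒜)
        - ∑ p, ∑ q, (Q i p : Superfield 𝒜) * (X p q : Superfield 𝒜) * (R q j : Superfield 𝒜),
      sub_mem (P i j).2 (sum_mem fun p _ => sum_mem fun q _ =>
        fermionic_mul_fermionic (fermionic_mul_bosonic (Q i p).2 (X p q).2) (R q j).2)⟩

variable [IsSupercommutative 𝒜]

/-- The Berezinian of the even supermatrix with bosonic blocks `P`, `S` and fermionic blocks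
`Q`, `R` (rows `P Q` and `R S`), for invertible `S`:
`Ber = det (P - Q S⁻¹ R) (det S)⁻¹`. -/
noncomputable def ber {k l : ℕ} (P : Matrix (Fin k) (Fin k) (bosonic 𝒜))
    (Q : Matrix (Fin k) (Fin l) (fermionic 𝒜)) (R : Matrix (Fin l) (Fin k) (fermionic 𝒜))
    (S : Matrix (Fin l) (Fin l) (bosonic 𝒜)) : bosonic 𝒜 :=
  (schur P Q S⁻¹ R).det * Ring.inverse S.det

/-- The inverse Berezinian of the same supermatrix, for invertible `P`:
`Ber⁻¹ = det (S - R P⁻¹ Q) (det P)⁻¹`. -/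
noncomputable def berInv {k l : ℕ} (P : Matrix (Fin k) (Fin k) (bosonic 𝒜))
    (Q : Matrix (Fin k) (Fin l) (fermionic 𝒜)) (R : Matrix (Fin l) (Fin k) (fermionic 𝒜))
    (S : Matrix (Fin l) (Fin l) (bosonic 𝒜)) : bosonic 𝒜 :=
  (schur S R P⁻¹ Q).det * Ring.inverse P.det

/-- The Wronskian-type Berezinian
`Ber_{(k,l)}[b_0, …, b_{k-1}; o_0, …, o_{l-1}]`. -/
noncomputable def wronskianBer {k l : ℕ} (b : Fin k → bosonic 𝒜) (o : Fin l → fermionic 𝒜) :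
    bosonic 𝒜 :=
  ber (wronskianMatrix (dxB δ) k b) (wronskianMatrix (dxF δ) k o)
    (wronskianMatrix (dxF δ) l fun j => superDB δ (b j))
    (wronskianMatrix (dxB δ) l fun j => superDF δ (o j))

/-- The inverse of the Wronskian-type Berezinian, as given by the upper left block. -/
noncomputable def wronskianBerInv {k l : ℕ} (b : Fin k → bosonic 𝒜)
    (o : Fin l → fermionic 𝒜) : bosonic 𝒜 :=
  berInv (wronskianMatrix (dxB δ) k b) (wronskianMatrix (dxF δ) k o)
    (wronskianMatrix (dxF δ) l fun j => superDB δ (b j))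
    (wronskianMatrix (dxB δ) l fun j => superDF δ (o j))

/-- `Ber_{(k,l)}[b; o]` is defined: the lower right block `(∂^i 𝒟 o_j)` is invertible. -/
def WronskianBerDefined {k l : ℕ} (_b : Fin k → bosonic 𝒜) (o : Fin l → fermionic 𝒜) : Prop :=
  IsUnit (wronskianMatrix (dxB δ) l fun j => superDF δ (o j))

/-- The expression for `(Ber_{(k,l)}[b; o])⁻¹` through the upper left block is defined: this block
`(∂^i b_j)` is invertible. -/
def WronskianBerInvDefined {k l : ℕ} (b : Fin k → bosonic 𝒜) (_o : Fin l → fermionic 𝒜) : Prop :=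
  IsUnit (wronskianMatrix (dxB δ) k b)

end Operators

end Superfield

open Superfield

/-! Each `gauge` factor is `𝒟` minus multiplication by a fermionic superfield, so the product `L` of
the first `m` factors is a monic superdifferential operator of order `m`. Since `χ_j 𝒟 χ_j⁻¹` kills
`χ_j`, `L` annihilates the first `m` superfields of the sequence. Because `𝒟² = ∂`, for `m = 2n` the
operator reads `∂^n + ∑ c_i ∂^i + ∑ γ_i ∂^i 𝒟`. Its coefficients therefore describe a row operation
on the supermatrix of `Ber_{(n+1,n)}`: on the column of a superfield `f` it turns the last row of
the upper blocks into `L f`. All entries become `0` except `L Φ`, and the Berezinian is `L Φ` times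
`Ber_{(n,n)}` (`det_schur_succ`, `wronskianBer_firstNSnoc`). For `m = 2n + 1` the same argument with
the diagonal blocks exchanged applies to the inverse Berezinian.

Definedness is propagated by induction along the chain `(n,n)`, `(n+1,n)`, `(n+1,n+1)`: each step
multiplies `Ber` or `Ber⁻¹` by the invertible `χ_j`. Passing between the two expressions rests on
`det (1 - X Y) * det (1 - Y X) = 1` for fermionic matrices (`oddSylvester_fin`). It gives `Ber *
Ber⁻¹ = 1` (`ber_mul_berInv`), and shows that a block with invertible Schur complement is itself
invertible (`isUnit_det_of_isUnit_det_schur`). -/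

namespace Superfield

/-! ### Homogeneous superfields and the twisted Leibniz rule for `𝒟`. -/

section Parity

variable {𝕜 A : Type*} [Field 𝕜] [Ring A] [Algebra 𝕜 A]
variable {𝒜 : ZMod 2 → Submodule 𝕜 A} [GradedAlgebra 𝒜]

theorem zmod_two_cases (p : ZMod 2) : p = 0 ∨ p = 1 := by
  revert p; decide

theorem parity_mem {p : ZMod 2} {a : A} (h : a ∈ 𝒜 p) : parity 𝒜 a ∈ 𝒜 p := by
  obtain rfl | rfl := zmod_two_cases p
  · rwa [parity_even 𝒜 h]
  · rw [parity_odd 𝒜 h]; exact Submodule.neg_mem _ h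

theorem parity_neg (a : A) : parity 𝒜 (-a) = -parity 𝒜 a := by
  have h := parity_add 𝒜 a (-a)
  rw [add_neg_cancel, parity_zero] at h
  exact (neg_eq_of_add_eq_zero_right h.symm).symm

theorem parity_parity (a : A) : parity 𝒜 (parity 𝒜 a) = a := by
  obtain ⟨b, hb, c, hc, rfl⟩ := exists_even_add_odd 𝒜 a
  simp only [parity_add, parity_even 𝒜 hb, parity_odd 𝒜 hc, parity_neg, neg_neg]

/-- The odd part `c` satisfies `2c = 0`; this is where characteristic `0` enters. -/
theorem mem_even_of_parity_eq [CharZero 𝕜] {a : A} (h : parity 𝒜 a = a) : a ∈ 𝒜 0 := by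
  obtain ⟨b, hb, c, hc, rfl⟩ := exists_even_add_odd 𝒜 a
  rw [parity_add, parity_even 𝒜 hb, parity_odd 𝒜 hc, add_right_inj] at h
  have h2 : (2 : 𝕜) • c = 0 := by
    rw [two_smul]; nth_rewrite 1 [← h]; exact neg_add_cancel c
  have hc0 : c = 0 := (smul_eq_zero_iff_right (two_ne_zero)).1 h2
  rwa [hc0, add_zero]

/-- The homogeneous superfields of parity `p`. -/
def IsHomog (𝒜 : ZMod 2 → Submodule 𝕜 A) (p : ZMod 2) (f : Superfield 𝒜) : Prop :=
  f.lower ∈ 𝒜 p ∧ f.upper ∈ 𝒜 (p + 1)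

theorem isHomog_zero_iff {f : Superfield 𝒜} : IsHomog 𝒜 0 f ↔ f ∈ bosonic 𝒜 := Iff.rfl

theorem isHomog_one_iff {f : Superfield 𝒜} : IsHomog 𝒜 1 f ↔ f ∈ fermionic 𝒜 := Iff.rfl

namespace IsHomog

variable {p q : ZMod 2} {f g : Superfield 𝒜}

omit [GradedAlgebra 𝒜] in
theorem zero : IsHomog 𝒜 p 0 := ⟨Submodule.zero_mem _, Submodule.zero_mem _⟩

omit [GradedAlgebra 𝒜] in
theorem add (hf : IsHomog 𝒜 p f) (hg : IsHomog 𝒜 p g) : IsHomog 𝒜 p (f + g) :=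
  ⟨Submodule.add_mem _ hf.1 hg.1, Submodule.add_mem _ hf.2 hg.2⟩

omit [GradedAlgebra 𝒜] in
theorem neg (hf : IsHomog 𝒜 p f) : IsHomog 𝒜 p (-f) :=
  ⟨Submodule.neg_mem _ hf.1, Submodule.neg_mem _ hf.2⟩

theorem sub (hf : IsHomog 𝒜 p f) (hg : IsHomog 𝒜 p g) : IsHomog 𝒜 p (f - g) := by
  rw [sub_eq_add_neg]; exact hf.add hg.neg

theorem sum {ι : Type*} {s : Finset ι} {u : ι → Superfield 𝒜}
    (h : ∀ i ∈ s, IsHomog 𝒜 p (u i)) : IsHomog 𝒜 p (∑ i ∈ s, u i) :=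
  Finset.sum_induction u (IsHomog 𝒜 p) (fun _ _ => add) zero h

theorem mul (hf : IsHomog 𝒜 p f) (hg : IsHomog 𝒜 q g) : IsHomog 𝒜 (p + q) (f * g) :=
  ⟨mul_mem' 𝒜 hf.1 hg.1 rfl, Submodule.add_mem _
    (mul_mem' 𝒜 hf.2 hg.1 (by ring)) (mul_mem' 𝒜 (parity_mem hf.1) hg.2 (by ring))⟩

theorem superD (δ : EvenDerivation 𝒜) (hf : IsHomog 𝒜 p f) :
    IsHomog 𝒜 (p + 1) (superD δ f) := by
  refine ⟨by rw [superD_lower]; exact hf.2, ?_⟩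
  rw [superD_upper, add_assoc, show (1 : ZMod 2) + 1 = 0 from by decide, add_zero]
  exact δ.map_mem _ _ hf.1

end IsHomog

/-- The parity involution of superfields. -/
def invol (f : Superfield 𝒜) : Superfield 𝒜 := ⟨parity 𝒜 f.lower, -parity 𝒜 f.upper⟩

theorem IsHomog.invol {p : ZMod 2} {f : Superfield 𝒜} (hf : IsHomog 𝒜 p f) :
    IsHomog 𝒜 p (invol f) :=
  ⟨parity_mem hf.1, Submodule.neg_mem _ (parity_mem hf.2)⟩

theorem invol_of_bosonic {f : Superfield 𝒜} (hf : f ∈ bosonic 𝒜) : invol f = f := by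
  ext
  · exact parity_even 𝒜 hf.1
  · change -parity 𝒜 f.upper = _
    rw [parity_odd 𝒜 hf.2, neg_neg]

variable (δ : EvenDerivation 𝒜)

theorem superD_add (f g : Superfield 𝒜) : superD δ (f + g) = superD δ f + superD δ g := by
  ext <;> simp [superD_lower, superD_upper]

theorem superD_zero : superD δ (0 : Superfield 𝒜) = 0 := by
  ext <;> simp [superD_lower, superD_upper]

theorem superD_sum {ι : Type*} (s : Finset ι) (u : ι → Superfield 𝒜) :
    superD δ (∑ i ∈ s, u i) = ∑ i ∈ s, superD δ (u i) :=
  map_sum (AddMonoidHom.mk' (superD δ) (superD_add δ)) u s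

omit [GradedAlgebra 𝒜] in
theorem derivation_one : δ.toLinearMap (1 : A) = 0 := by
  simpa using δ.leibniz 1 1

theorem superD_one : superD δ (1 : Superfield 𝒜) = 0 := by
  ext <;> simp [superD_lower, superD_upper, derivation_one]

theorem superD_mul (f g : Superfield 𝒜) :
    superD δ (f * g) = superD δ f * g + invol f * superD δ g := by
  ext
  · simp [superD_lower, invol]
  · simp [superD_lower, superD_upper, invol, parity_parity, δ.leibniz]

theorem superD_superD (f : Superfield 𝒜) : superD δ (superD δ f) = dx δ f := by
  ext <;> simp [superD_lower, superD_upper, dx]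

theorem superD_iterate_two_mul (i : ℕ) (f : Superfield 𝒜) :
    (superD δ)^[2 * i] f = (dx δ)^[i] f := by
  rw [Function.iterate_mul]
  congr 1
  funext g
  exact superD_superD δ g

theorem coe_dxB_iterate (i : ℕ) (f : bosonic 𝒜) :
    (((dxB δ)^[i] f : bosonic 𝒜) : Superfield 𝒜) = (dx δ)^[i] f := by
  induction i with
  | zero => rfl
  | succ i ih => rw [Function.iterate_succ_apply', Function.iterate_succ_apply', ← ih]; rfl

theorem coe_dxF_iterate (i : ℕ) (f : fermionic 𝒜) :
    (((dxF δ)^[i] f : fermionic 𝒜) : Superfield 𝒜) = (dx δ)^[i] f := by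
  induction i with
  | zero => rfl
  | succ i ih => rw [Function.iterate_succ_apply', Function.iterate_succ_apply', ← ih]; rfl

end Parity

/-! ### Supercommutation rules and inverses of bosonic superfields. -/

section Commutation

variable {𝕜 A : Type*} [Field 𝕜] [Ring A] [Algebra 𝕜 A]
variable {𝒜 : ZMod 2 → Submodule 𝕜 A} [GradedAlgebra 𝒜] [IsSupercommutative 𝒜]

theorem even_comm {a : A} (ha : a ∈ 𝒜 0) (b : A) : a * b = b * a := by
  obtain ⟨c, hc, d, hd, rfl⟩ := exists_even_add_odd 𝒜 b
  have h0 := IsSupercommutative.comm 0 0 a c ha hc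
  have h1 := IsSupercommutative.comm 0 1 a d ha hd
  simp only [ZMod.val_zero, zero_mul, pow_zero, one_mul] at h0 h1
  rw [mul_add, add_mul, h0, h1]

omit [GradedAlgebra 𝒜] in
theorem odd_anticomm {a b : A} (ha : a ∈ 𝒜 1) (hb : b ∈ 𝒜 1) : a * b = -(b * a) := by
  have h := IsSupercommutative.comm 1 1 a b ha hb
  rwa [show (1 : ZMod 2).val = 1 from rfl, mul_one, pow_one, neg_one_mul] at h

theorem odd_comm {a : A} (ha : a ∈ 𝒜 1) (b : A) : a * b = parity 𝒜 b * a := by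
  obtain ⟨c, hc, d, hd, rfl⟩ := exists_even_add_odd 𝒜 b
  rw [parity_add, parity_even 𝒜 hc, parity_odd 𝒜 hd, mul_add, add_mul, odd_anticomm ha hd,
    even_comm hc, neg_mul]

theorem bosonic_comm {f : Superfield 𝒜} (hf : f ∈ bosonic 𝒜) (g : Superfield 𝒜) :
    f * g = g * f := by
  ext
  · exact even_comm hf.1 _
  · rw [mul_upper, mul_upper, parity_even 𝒜 hf.1, even_comm hf.1, odd_comm hf.2, add_comm]

theorem fermionic_anticomm {f g : Superfield 𝒜} (hf : f ∈ fermionic 𝒜)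
    (hg : g ∈ fermionic 𝒜) : f * g = -(g * f) := by
  ext
  · exact odd_anticomm hf.1 hg.1
  · rw [neg_upper, mul_upper, mul_upper, parity_odd 𝒜 hf.1, parity_odd 𝒜 hg.1,
      even_comm hf.2, even_comm hg.2]
    simp only [neg_mul, neg_add_rev, neg_neg]

theorem fermionic_sq [CharZero 𝕜] {f : Superfield 𝒜} (hf : f ∈ fermionic 𝒜) : f * f = 0 := by
  have h := fermionic_anticomm hf hf
  have key : ∀ a : A, a = -a → a = 0 := by
    intro a ha
    have h2 : (2 : 𝕜) • a = 0 := by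
      rw [two_smul]; nth_rewrite 1 [ha]; exact neg_add_cancel a
    exact (smul_eq_zero_iff_right (two_ne_zero)).1 h2
  ext
  · exact key _ (congrArg Superfield.lower h)
  · exact key _ (congrArg Superfield.upper h)

variable (𝒜) in
/-- The inclusion of the bosonic superfields. -/
def bosonicVal : bosonic 𝒜 →+* Superfield 𝒜 where
  toFun f := f
  map_one' := rfl
  map_mul' _ _ := rfl
  map_zero' := rfl
  map_add' _ _ := rfl

@[simp] theorem bosonicVal_apply (f : bosonic 𝒜) : bosonicVal 𝒜 f = (f : Superfield 𝒜) := rfl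

theorem bosonicVal_injective : Function.Injective (bosonicVal 𝒜) := Subtype.val_injective

/-- Applying `parity` to `f₀ g₀ = 1` shows that `parity g₀` is also an inverse of `f₀`, so `g₀` is
even by uniqueness. Then `g₁ = -g₀ f₁ g₀` is odd. -/
theorem bosonic_of_mul_eq_one [CharZero 𝕜] {f g : Superfield 𝒜} (hf : f ∈ bosonic 𝒜)
    (h : f * g = 1) : g ∈ bosonic 𝒜 := by
  have h0 : f.lower * g.lower = 1 := congrArg Superfield.lower h
  have h1 : f.upper * g.lower + parity 𝒜 f.lower * g.upper = 0 := congrArg Superfield.upper h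
  rw [parity_even 𝒜 hf.1] at h1
  have h0' : g.lower * f.lower = 1 := by rw [← even_comm hf.1, h0]
  have hp : f.lower * parity 𝒜 g.lower = 1 := by
    have := congrArg (parity 𝒜) h0
    rwa [parity_mul, parity_even 𝒜 hf.1, parity_one] at this
  have hg : g.lower ∈ 𝒜 0 := mem_even_of_parity_eq (left_inv_eq_right_inv h0' hp).symm
  refine ⟨hg, ?_⟩
  have hu : g.upper = -(g.lower * (f.upper * g.lower)) := by
    rw [← mul_neg, ← eq_neg_of_add_eq_zero_right h1, ← mul_assoc, h0', one_mul]
  rw [hu]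
  exact Submodule.neg_mem _ (mul_mem' 𝒜 hg (mul_mem' 𝒜 hf.2 hg (by decide : 1 + 0 = (1 : ZMod 2)))
    (by decide))

/-- The superfields `χ_j` are assumed invertible among all superfields, while determinants need
units of the commutative ring `bosonic 𝒜`. -/
theorem isUnit_bosonic_iff [CharZero 𝕜] {f : bosonic 𝒜} :
    IsUnit f ↔ IsUnit (f : Superfield 𝒜) := by
  refine ⟨fun h => h.map (bosonicVal 𝒜), fun h => ?_⟩
  obtain ⟨g, hg⟩ := h.exists_right_inv
  exact IsUnit.of_mul_eq_one ⟨g, bosonic_of_mul_eq_one f.2 hg⟩ (Subtype.ext hg)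

end Commutation

/-! ### Determinants of bosonic matrices built from fermionic ones; the two forms of the Berezinian.
-/

section Matrices

variable {𝕜 A : Type*} [Field 𝕜] [Ring A] [Algebra 𝕜 A]
variable {𝒜 : ZMod 2 → Submodule 𝕜 A} [GradedAlgebra 𝒜] [IsSupercommutative 𝒜]
variable {m m' n n' : Type} [Fintype m] [Fintype m'] [Fintype n] [Fintype n']

/-- All entries of the matrix are fermionic. -/
def FermionicEntries (X : Matrix m n (Superfield 𝒜)) : Prop := ∀ i j, X i j ∈ fermionic 𝒜

omit [Fintype m] [Fintype n'] in
omit [IsSupercommutative 𝒜] in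
theorem mul_mem_bosonic {X : Matrix m n (Superfield 𝒜)} {Y : Matrix n n' (Superfield 𝒜)}
    (hX : FermionicEntries X) (hY : FermionicEntries Y) (i : m) (j : n') :
    (X * Y) i j ∈ bosonic 𝒜 :=
  sum_mem fun p _ => fermionic_mul_fermionic (hX i p) (hY p j)

omit [Fintype m] [Fintype n'] in
theorem FermionicEntries.bosonic_mul {X : Matrix m n (bosonic 𝒜)}
    {Y : Matrix n n' (Superfield 𝒜)} (hY : FermionicEntries Y) :
    FermionicEntries (X.map (bosonicVal 𝒜) * Y) := fun i j =>
  sum_mem fun p _ => by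
    change (X i p : Superfield 𝒜) * Y p j ∈ fermionic 𝒜
    rw [bosonic_comm (X i p).2]
    exact fermionic_mul_bosonic (hY p j) (X i p).2

omit [Fintype m] [Fintype n] in
theorem exists_map_bosonicVal (X : Matrix m n (Superfield 𝒜)) (h : ∀ i j, X i j ∈ bosonic 𝒜) :
    ∃ Y : Matrix m n (bosonic 𝒜), Y.map (bosonicVal 𝒜) = X :=
  ⟨Matrix.of fun i j => ⟨X i j, h i j⟩, rfl⟩

omit [Fintype m] [Fintype n] in
theorem map_bosonicVal_injective {X Y : Matrix m n (bosonic 𝒜)}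
    (h : X.map (bosonicVal 𝒜) = Y.map (bosonicVal 𝒜)) : X = Y :=
  Matrix.map_injective bosonicVal_injective h

variable [DecidableEq m] [DecidableEq m'] [DecidableEq n] [DecidableEq n']

omit [Fintype m] [DecidableEq n] in
theorem exists_map_eq_one_sub {X : Matrix m n (Superfield 𝒜)} {Y : Matrix n m (Superfield 𝒜)}
    (hX : FermionicEntries X) (hY : FermionicEntries Y) :
    ∃ B : Matrix m m (bosonic 𝒜), B.map (bosonicVal 𝒜) = 1 - X * Y := by
  refine exists_map_bosonicVal _ fun i j => sub_mem ?_ (mul_mem_bosonic hX hY i j)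
  rw [Matrix.one_apply]
  split_ifs
  exacts [one_mem _, zero_mem _]

theorem map_inv_mul_map {B : Matrix m m (bosonic 𝒜)} (h : IsUnit B.det) :
    B⁻¹.map (bosonicVal 𝒜) * B.map (bosonicVal 𝒜) = 1 := by
  rw [← Matrix.map_mul, Matrix.nonsing_inv_mul _ h, Matrix.map_one _ (map_zero _) (map_one _)]

theorem map_mul_map_inv {B : Matrix m m (bosonic 𝒜)} (h : IsUnit B.det) :
    B.map (bosonicVal 𝒜) * B⁻¹.map (bosonicVal 𝒜) = 1 := by
  rw [← Matrix.map_mul, Matrix.mul_nonsing_inv _ h, Matrix.map_one _ (map_zero _) (map_one _)]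

variable (𝒜 m n) in
/-- `det (1 - X Y) * det (1 - Y X) = 1` for all fermionic `m × n` matrices `X` and
`n × m` matrices `Y`. -/
def OddSylvester : Prop :=
  ∀ (X : Matrix m n (Superfield 𝒜)) (Y : Matrix n m (Superfield 𝒜)),
    FermionicEntries X → FermionicEntries Y →
    ∀ (B : Matrix m m (bosonic 𝒜)) (C : Matrix n n (bosonic 𝒜)),
      B.map (bosonicVal 𝒜) = 1 - X * Y → C.map (bosonicVal 𝒜) = 1 - Y * X →
      B.det * C.det = 1

theorem OddSylvester.symm (h : OddSylvester 𝒜 m n) : OddSylvester 𝒜 n m :=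
  fun X Y hX hY B C hB hC => by rw [mul_comm]; exact h Y X hY hX C B hC hB

theorem OddSylvester.congr (e : m' ≃ m) (h : OddSylvester 𝒜 m n) : OddSylvester 𝒜 m' n := by
  intro X Y hX hY B C hB hC
  rw [← Matrix.det_submatrix_equiv_self e.symm B]
  refine h (X.submatrix e.symm id) (Y.submatrix id e.symm) (fun i j => hX _ _)
    (fun i j => hY _ _) _ C ?_ ?_
  · rw [← Matrix.submatrix_map, hB]
    change (1 : Matrix m' m' _).submatrix e.symm e.symm - (X * Y).submatrix e.symm e.symm = _
    rw [Matrix.submatrix_one_equiv]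
    rfl
  · rw [hC, Matrix.submatrix_mul_equiv Y X id e.symm id]
    rfl

/-- With `X` split into rows `X₁, X₂` and `Y` into columns `Y₁, Y₂`, put `G = (1 - Y₁ X₁)⁻¹`. The
Schur complement of `1 - X₁ Y₁` in `1 - X Y` is `1 - X₂ G Y₂`, and `1 - Y X = (1 - Y₁ X₁)(1 - G Y₂
X₂)`. So both determinants factor, and the factors pair off: `h` serves for `X₁, Y₁` and `h'` for
`X₂, G Y₂`. -/
theorem OddSylvester.sum (h : OddSylvester 𝒜 m n) (h' : OddSylvester 𝒜 m' n) :
    OddSylvester 𝒜 (m ⊕ m') n := by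
  intro X Y hX hY B C hB hC
  set X₁ := X.toRows₁
  set X₂ := X.toRows₂
  set Y₁ := Y.toCols₁
  set Y₂ := Y.toCols₂
  have hX₁ : FermionicEntries X₁ := fun i j => hX _ _
  have hX₂ : FermionicEntries X₂ := fun i j => hX _ _
  have hY₁ : FermionicEntries Y₁ := fun i j => hY _ _
  have hY₂ : FermionicEntries Y₂ := fun i j => hY _ _
  have hXe : X = Matrix.fromRows X₁ X₂ := (Matrix.fromRows_toRows X).symm
  have hYe : Y = Matrix.fromCols Y₁ Y₂ := (Matrix.fromCols_toCols Y).symm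
  have hC' : C.map (bosonicVal 𝒜) = 1 - Y₁ * X₁ - Y₂ * X₂ := by
    rw [hC, hXe, hYe, Matrix.fromCols_mul_fromRows, sub_sub]
  have hBe : (Matrix.fromBlocks B.toBlocks₁₁ B.toBlocks₁₂ B.toBlocks₂₁ B.toBlocks₂₂).map
      (bosonicVal 𝒜) = Matrix.fromBlocks (1 - X₁ * Y₁) (-(X₁ * Y₂)) (-(X₂ * Y₁))
        (1 - X₂ * Y₂) := by
    rw [Matrix.fromBlocks_toBlocks, hB, hXe, hYe, Matrix.fromRows_mul_fromCols,
      ← Matrix.fromBlocks_one, sub_eq_add_neg, Matrix.fromBlocks_neg, Matrix.fromBlocks_add,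
      zero_add, zero_add, ← sub_eq_add_neg, ← sub_eq_add_neg]
  rw [Matrix.fromBlocks_map, Matrix.fromBlocks_inj] at hBe
  obtain ⟨h₁₁, h₁₂, h₂₁, h₂₂⟩ := hBe
  obtain ⟨C₁, hC₁⟩ := exists_map_eq_one_sub hY₁ hX₁
  have hdet := h X₁ Y₁ hX₁ hY₁ _ _ h₁₁ hC₁
  have hBu : IsUnit B.toBlocks₁₁.det := IsUnit.of_mul_eq_one _ hdet
  have hCu : IsUnit C₁.det := IsUnit.of_mul_eq_one _ ((mul_comm _ _).trans hdet)
  have e₁ := map_mul_map_inv hBu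
  have e₂ := map_inv_mul_map hCu
  set V := B.toBlocks₁₁⁻¹.map (bosonicVal 𝒜)
  set G := C₁⁻¹.map (bosonicVal 𝒜)
  rw [h₁₁, sub_mul, one_mul, sub_eq_iff_eq_add] at e₁
  rw [hC₁] at e₂
  -- The push-through identity `(1 - Y₁ X₁)⁻¹ = 1 + Y₁ (1 - X₁ Y₁)⁻¹ X₁`.
  have hG : G = 1 + Y₁ * V * X₁ := by
    have h3 : (1 - Y₁ * X₁) * (1 + Y₁ * V * X₁) = 1 := by
      have : Y₁ * X₁ * (Y₁ * V * X₁) = Y₁ * (X₁ * Y₁ * V) * X₁ := by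
        simp only [Matrix.mul_assoc]
      rw [sub_mul, mul_add, mul_add, one_mul, mul_one, one_mul, this]
      nth_rewrite 1 [e₁]
      rw [Matrix.mul_add, Matrix.add_mul, Matrix.mul_one]
      abel
    exact left_inv_eq_right_inv e₂ h3
  have hdetC : C.det = C₁.det * (C₁⁻¹ * C).det := by
    rw [← Matrix.det_mul, ← Matrix.mul_assoc, Matrix.mul_nonsing_inv _ hCu, Matrix.one_mul]
  let _ := Matrix.invertibleOfIsUnitDet _ hBu
  have hdetB : B.det = B.toBlocks₁₁.det *
      (B.toBlocks₂₂ - B.toBlocks₂₁ * B.toBlocks₁₁⁻¹ * B.toBlocks₁₂).det := by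
    conv_lhs => rw [← Matrix.fromBlocks_toBlocks B]
    rw [Matrix.det_fromBlocks₁₁, Matrix.invOf_eq_nonsing_inv]
  have key := h' X₂ (G * Y₂) hX₂ hY₂.bosonic_mul
    (B.toBlocks₂₂ - B.toBlocks₂₁ * B.toBlocks₁₁⁻¹ * B.toBlocks₁₂) (C₁⁻¹ * C) (by
      rw [Matrix.map_sub _ (map_sub _), Matrix.map_mul, Matrix.map_mul, h₂₂, h₂₁, h₁₂, hG,
        Matrix.add_mul, Matrix.mul_add]
      simp only [Matrix.neg_mul, Matrix.mul_neg, neg_neg, Matrix.mul_assoc, Matrix.one_mul]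
      rw [sub_sub]) (by
      rw [Matrix.map_mul, hC', Matrix.mul_sub, e₂, Matrix.mul_assoc])
  rw [hdetB, hdetC, mul_mul_mul_comm, hdet, key, one_mul]

theorem OddSylvester.fin_left (h : OddSylvester 𝒜 (Fin 1) n) (k : ℕ) :
    OddSylvester 𝒜 (Fin k) n := by
  induction k with
  | zero =>
    intro X Y hX hY B C hB hC
    have : C = 1 := map_bosonicVal_injective (by
      rw [hC, Matrix.map_one _ (map_zero _) (map_one _)]
      ext1 i j
      simp)
    rw [this, Matrix.det_one, Matrix.det_isEmpty, one_mul]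
  | succ k ih => exact (ih.sum h).congr finSumFinEquiv.symm

/-- For fermionic `x, y` one has `yx = -xy` and `xyyx = 0`, so `(1 - xy)(1 - yx) = 1`. The
anticommutation is why the determinants are inverse to each other, not equal as for commuting
entries. -/
theorem oddSylvester_one [CharZero 𝕜] : OddSylvester 𝒜 (Fin 1) (Fin 1) := by
  intro X Y hX hY B C hB hC
  have hB0 := congrFun (congrFun hB 0) 0
  have hC0 := congrFun (congrFun hC 0) 0
  simp only [Matrix.map_apply, bosonicVal_apply, Matrix.sub_apply, Matrix.one_apply_eq,
    Matrix.mul_apply, Fin.sum_univ_one] at hB0 hC0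
  rw [Matrix.det_fin_one, Matrix.det_fin_one]
  apply Subtype.ext
  change (B 0 0 : Superfield 𝒜) * (C 0 0 : Superfield 𝒜) = 1
  have h1 : X 0 0 * Y 0 0 * (Y 0 0 * X 0 0) = 0 := by
    rw [mul_assoc, ← mul_assoc (Y 0 0), fermionic_sq (hY 0 0), zero_mul, mul_zero]
  rw [hB0, hC0, sub_mul, mul_sub, mul_sub, one_mul, mul_one, h1,
    fermionic_anticomm (hX 0 0) (hY 0 0)]
  simp

theorem oddSylvester_fin [CharZero 𝕜] (k l : ℕ) : OddSylvester 𝒜 (Fin k) (Fin l) :=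
  ((oddSylvester_one.fin_left l).symm).fin_left k

/-- The entrywise inclusion of a fermionic matrix. -/
def fermionicMap {m n : Type} (X : Matrix m n (fermionic 𝒜)) : Matrix m n (Superfield 𝒜) :=
  X.map fun f => (f : Superfield 𝒜)

omit [IsSupercommutative 𝒜] in
theorem fermionicEntries_map {m n : Type} (X : Matrix m n (fermionic 𝒜)) :
    FermionicEntries (fermionicMap X) := fun i j => (X i j).2

omit [IsSupercommutative 𝒜] in
theorem FermionicEntries.neg {m n : Type} {X : Matrix m n (Superfield 𝒜)}
    (h : FermionicEntries X) : FermionicEntries (-X) := fun i j => neg_mem (h i j)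

theorem map_schur {k l : ℕ} (P : Matrix (Fin k) (Fin k) (bosonic 𝒜))
    (Q : Matrix (Fin k) (Fin l) (fermionic 𝒜)) (X : Matrix (Fin l) (Fin l) (bosonic 𝒜))
    (R : Matrix (Fin l) (Fin k) (fermionic 𝒜)) :
    (schur P Q X R).map (bosonicVal 𝒜) = P.map (bosonicVal 𝒜) -
      fermionicMap Q * X.map (bosonicVal 𝒜) * fermionicMap R := by
  ext1 i j
  simp only [schur, fermionicMap, Matrix.map_apply, Matrix.of_apply, bosonicVal_apply,
    Matrix.sub_apply, Matrix.mul_apply, Finset.sum_mul]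
  rw [Finset.sum_comm]

theorem map_inv_mul_schur {k l : ℕ} (P : Matrix (Fin k) (Fin k) (bosonic 𝒜))
    (Q : Matrix (Fin k) (Fin l) (fermionic 𝒜)) (X : Matrix (Fin l) (Fin l) (bosonic 𝒜))
    (R : Matrix (Fin l) (Fin k) (fermionic 𝒜)) (hP : IsUnit P.det) :
    (P⁻¹ * schur P Q X R).map (bosonicVal 𝒜) = 1 -
      (P⁻¹.map (bosonicVal 𝒜) * fermionicMap Q) * (X.map (bosonicVal 𝒜) * fermionicMap R) := by
  rw [Matrix.map_mul, map_schur, Matrix.mul_sub, map_inv_mul_map hP]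
  simp only [Matrix.mul_assoc]

/-- If `Z` is the Schur complement, `Z⁻¹ P = 1 + (Z⁻¹ Q)(X R)` differs from `1` by a product of
fermionic matrices, and its determinant is a unit by `oddSylvester_fin`. -/
theorem isUnit_det_of_isUnit_det_schur [CharZero 𝕜] {k l : ℕ}
    {P : Matrix (Fin k) (Fin k) (bosonic 𝒜)}
    {Q : Matrix (Fin k) (Fin l) (fermionic 𝒜)} {X : Matrix (Fin l) (Fin l) (bosonic 𝒜)}
    {R : Matrix (Fin l) (Fin k) (fermionic 𝒜)} (h : IsUnit (schur P Q X R).det) :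
    IsUnit P.det := by
  set Z := schur P Q X R with hZ
  have hP : P.map (bosonicVal 𝒜) = Z.map (bosonicVal 𝒜) +
      fermionicMap Q * X.map (bosonicVal 𝒜) * fermionicMap R := by
    rw [hZ, map_schur, sub_add_cancel]
  have hB : (Z⁻¹ * P).map (bosonicVal 𝒜) = 1 -
      -(Z⁻¹.map (bosonicVal 𝒜) * fermionicMap Q) * (X.map (bosonicVal 𝒜) * fermionicMap R) := by
    rw [Matrix.map_mul, hP, Matrix.mul_add, map_inv_mul_map h, Matrix.neg_mul, sub_neg_eq_add]
    simp only [Matrix.mul_assoc]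
  have hX := ((fermionicEntries_map Q).bosonic_mul (X := Z⁻¹)).neg
  have hY := (fermionicEntries_map R).bosonic_mul (X := X)
  obtain ⟨C, hC⟩ := exists_map_eq_one_sub hY hX
  have hu := IsUnit.of_mul_eq_one _ (oddSylvester_fin k l _ _ hX hY _ C hB hC)
  rw [← Matrix.one_mul P, ← Matrix.mul_nonsing_inv _ h, Matrix.mul_assoc, Matrix.det_mul]
  exact h.mul hu

/-- `P⁻¹ (P - Q S⁻¹ R) = 1 - X Y` and `S⁻¹ (S - R P⁻¹ Q) = 1 - Y X` with `X = P⁻¹ Q` and `Y = S⁻¹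
R`. -/
theorem ber_mul_berInv [CharZero 𝕜] {k l : ℕ} {P : Matrix (Fin k) (Fin k) (bosonic 𝒜)}
    (Q : Matrix (Fin k) (Fin l) (fermionic 𝒜)) (R : Matrix (Fin l) (Fin k) (fermionic 𝒜))
    {S : Matrix (Fin l) (Fin l) (bosonic 𝒜)} (hP : IsUnit P.det) (hS : IsUnit S.det) :
    ber P Q R S * berInv P Q R S = 1 := by
  have key := oddSylvester_fin k l _ _
    ((fermionicEntries_map Q).bosonic_mul (X := P⁻¹))
    ((fermionicEntries_map R).bosonic_mul (X := S⁻¹)) _ _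
    (map_inv_mul_schur P Q S⁻¹ R hP) (map_inv_mul_schur S R P⁻¹ Q hS)
  rw [Matrix.det_mul, Matrix.det_mul, Matrix.det_nonsing_inv, Matrix.det_nonsing_inv] at key
  rw [ber, berInv, ← key]
  ring

end Matrices

/-! ### Row operations on a supermatrix, carried out on its Schur complement. -/

section RowReduction

variable {𝕜 A : Type*} [Field 𝕜] [Ring A] [Algebra 𝕜 A]
variable {𝒜 : ZMod 2 → Submodule 𝕜 A} [GradedAlgebra 𝒜] [IsSupercommutative 𝒜]

theorem det_eq_mul_of_last_row {B : Type*} [CommRing B] {k : ℕ}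
    (M : Matrix (Fin (k + 1)) (Fin (k + 1)) B) (c : Fin k → B) (t : B)
    (h : ∀ j, M (Fin.last k) j + ∑ i, c i * M i.castSucc j = if j = Fin.last k then t else 0) :
    M.det = t * (M.submatrix Fin.castSucc Fin.castSucc).det := by
  -- The last row itself enters with weight `1`, so the determinant is unchanged.
  have h1 := Matrix.det_updateRow_sum M (Fin.last k) (Fin.snoc c 1)
  rw [Fin.snoc_last, one_smul] at h1
  have hrow : (∑ i, (Fin.snoc c 1 : Fin (k + 1) → B) i • M i) =
      fun j => if j = Fin.last k then t else 0 := by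
    funext j
    rw [← h j, Finset.sum_apply, Fin.sum_univ_castSucc]
    simp [add_comm]
  rw [← h1, hrow, Matrix.det_succ_row _ (Fin.last k), Finset.sum_eq_single (Fin.last k)]
  · rw [Matrix.updateRow_self, if_pos rfl, ← two_mul, pow_mul, neg_one_sq, one_pow, one_mul]
    congr 2
    ext1 i j
    simp [Fin.succAbove_last]
  · intro j _ hj
    rw [Matrix.updateRow_self, if_neg hj, mul_zero, zero_mul]
  · simp

/-- The coefficients `γ` need not be bosonic, so the combined row operation is not one over a
commutative ring. In the Schur complement only the bosonic `c` survive: multiplying `hQ` by `W = S⁻¹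
R` turns `γ S W` into `γ R`, which cancels the same term of `hP`. -/
theorem det_schur_succ {k l : ℕ} (P : Matrix (Fin (k + 1)) (Fin (k + 1)) (bosonic 𝒜))
    (Q : Matrix (Fin (k + 1)) (Fin l) (fermionic 𝒜))
    (R : Matrix (Fin l) (Fin (k + 1)) (fermionic 𝒜))
    (S : Matrix (Fin l) (Fin l) (bosonic 𝒜)) (hS : IsUnit S.det)
    (c : Fin k → bosonic 𝒜) (γ : Fin l → Superfield 𝒜) (t : bosonic 𝒜)
    (hP : ∀ j, (P (Fin.last k) j : Superfield 𝒜) + ∑ i, (c i : Superfield 𝒜) * P i.castSucc j +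
      ∑ q, γ q * R q j = if j = Fin.last k then (t : Superfield 𝒜) else 0)
    (hQ : ∀ j, (Q (Fin.last k) j : Superfield 𝒜) + ∑ i, (c i : Superfield 𝒜) * Q i.castSucc j +
      ∑ q, γ q * S q j = 0) :
    (schur P Q S⁻¹ R).det = t * (schur (P.submatrix Fin.castSucc Fin.castSucc)
      (Q.submatrix Fin.castSucc id) S⁻¹ (R.submatrix id Fin.castSucc)).det := by
  have hsub : schur (P.submatrix Fin.castSucc Fin.castSucc)
      (Q.submatrix Fin.castSucc id) S⁻¹ (R.submatrix id Fin.castSucc) =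
      (schur P Q S⁻¹ R).submatrix Fin.castSucc Fin.castSucc := rfl
  rw [hsub]
  refine det_eq_mul_of_last_row _ c t fun j => bosonicVal_injective ?_
  have hZ : ∀ i j, ((schur P Q S⁻¹ R i j : bosonic 𝒜) : Superfield 𝒜) = P i j -
      ∑ p, (Q i p : Superfield 𝒜) * (S⁻¹.map (bosonicVal 𝒜) * fermionicMap R) p j := by
    intro i j
    have := congrFun (congrFun (map_schur P Q S⁻¹ R) i) j
    rw [Matrix.mul_assoc, Matrix.sub_apply, Matrix.mul_apply] at this
    exact this
  set W := S⁻¹.map (bosonicVal 𝒜) * fermionicMap R with hW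
  have hSW : ∀ q j, ∑ p, (S q p : Superfield 𝒜) * W p j = R q j := by
    intro q j
    have h : S.map (bosonicVal 𝒜) * W = fermionicMap R := by
      rw [hW, ← Matrix.mul_assoc, map_mul_map_inv hS, Matrix.one_mul]
    have := congrFun (congrFun h q) j
    rw [Matrix.mul_apply] at this
    exact this
  have hQW : ∑ p, (Q (Fin.last k) p : Superfield 𝒜) * W p j +
      ∑ i, (c i : Superfield 𝒜) * ∑ p, (Q i.castSucc p : Superfield 𝒜) * W p j +
      ∑ q, γ q * (R q j : Superfield 𝒜) = 0 := by
    have h : ∑ p, ((Q (Fin.last k) p : Superfield 𝒜) +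
        ∑ i, (c i : Superfield 𝒜) * Q i.castSucc p + ∑ q, γ q * S q p) * W p j = 0 :=
      Finset.sum_eq_zero fun p _ => by rw [hQ, zero_mul]
    simp only [add_mul, Finset.sum_add_distrib, Finset.sum_mul] at h
    rw [Finset.sum_comm (s := Finset.univ) (t := Finset.univ)
      (f := fun p q => γ q * (S q p : Superfield 𝒜) * W p j),
      Finset.sum_comm (s := Finset.univ) (t := Finset.univ)
      (f := fun p i => (c i : Superfield 𝒜) * (Q i.castSucc p : Superfield 𝒜) * W p j)] at h
    simpa only [mul_assoc, ← Finset.mul_sum, hSW] using h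
  rw [map_add, map_sum]
  simp only [map_mul, bosonicVal_apply, hZ, mul_sub, Finset.sum_sub_distrib]
  have ht : ((if j = Fin.last k then t else 0 : bosonic 𝒜) : Superfield 𝒜) =
      if j = Fin.last k then (t : Superfield 𝒜) else 0 := by
    split_ifs <;> rfl
  have h := congrArg₂ (· - ·) (hP j) hQW
  rw [sub_zero] at h
  rw [ht, ← h]
  abel

end RowReduction

/-! ### Monic superdifferential operators and their composition with gauge factors. -/

section Operators

variable {𝕜 A : Type*} [Field 𝕜] [Ring A] [Algebra 𝕜 A]
variable {𝒜 : ZMod 2 → Submodule 𝕜 A} [GradedAlgebra 𝒜] [IsSupercommutative 𝒜]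
variable (δ : EvenDerivation 𝒜)

omit [IsSupercommutative 𝒜] in
theorem isHomog_one : IsHomog 𝒜 0 1 := isHomog_zero_iff.2 (one_mem _)

omit [IsSupercommutative 𝒜] in
theorem isHomog_iterate {p : ZMod 2} {f : Superfield 𝒜} (hf : IsHomog 𝒜 p f) (i : ℕ) :
    IsHomog 𝒜 (p + i) ((superD δ)^[i] f) := by
  induction i with
  | zero => simpa using hf
  | succ i ih =>
    rw [Function.iterate_succ_apply', Nat.cast_succ, ← add_assoc]
    exact ih.superD δ

/-- `L` is a homogeneous monic superdifferential operator of order `m`. -/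
def IsMonicOperator (m : ℕ) (L : Superfield 𝒜 → Superfield 𝒜) : Prop :=
  ∃ a : ℕ → Superfield 𝒜, a m = 1 ∧ (∀ i > m, a i = 0) ∧ (∀ i, IsHomog 𝒜 (m + i : ℕ) (a i)) ∧
    ∀ f, L f = ∑ i ∈ Finset.range (m + 1), a i * (superD δ)^[i] f

variable {δ}

theorem zmod_two_add_self (p : ZMod 2) : p + p = 0 := by revert p; decide

omit [IsSupercommutative 𝒜] in
theorem IsMonicOperator.isHomog {m : ℕ} {L : Superfield 𝒜 → Superfield 𝒜}
    (h : IsMonicOperator δ m L) {p : ZMod 2} {f : Superfield 𝒜} (hf : IsHomog 𝒜 p f) :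
    IsHomog 𝒜 (m + p) (L f) := by
  obtain ⟨a, -, -, ha, hL⟩ := h
  rw [hL]
  refine IsHomog.sum fun i _ => ?_
  have := (ha i).mul (isHomog_iterate δ hf i)
  rwa [Nat.cast_add, show (m + i + (p + i) : ZMod 2) = m + p + (i + i) by ring,
    zmod_two_add_self, add_zero] at this

/-- By the Leibniz rule `χ 𝒟 χ⁻¹ = 𝒟 + χ (𝒟 χ⁻¹)`; the sign is absorbed into `η`. -/
theorem gauge_eq [CharZero 𝕜] {χ : Superfield 𝒜} (hχ : χ ∈ bosonic 𝒜) (hu : IsUnit χ) :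
    ∃ η ∈ fermionic 𝒜, ∀ f, gauge δ χ f = superD δ f - η * f := by
  have h1 := Ring.mul_inverse_cancel χ hu
  have hi := bosonic_of_mul_eq_one hχ h1
  refine ⟨-(χ * superD δ (Ring.inverse χ)), ?_, fun f => ?_⟩
  · have := ((isHomog_zero_iff.2 hχ).mul ((isHomog_zero_iff.2 hi).superD δ)).neg
    rwa [zero_add, zero_add, isHomog_one_iff] at this
  · rw [gauge, superD_mul, invol_of_bosonic hi, mul_add, ← mul_assoc χ (Ring.inverse χ), h1,
      one_mul, neg_mul, sub_neg_eq_add, mul_assoc, add_comm]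

theorem IsMonicOperator.gauge_comp [CharZero 𝕜] {m : ℕ} {L : Superfield 𝒜 → Superfield 𝒜}
    (h : IsMonicOperator δ m L) {χ : Superfield 𝒜} (hχ : χ ∈ bosonic 𝒜) (hu : IsUnit χ) :
    IsMonicOperator δ (m + 1) fun f => gauge δ χ (L f) := by
  obtain ⟨η, hη, hg⟩ := gauge_eq (δ := δ) hχ hu
  obtain ⟨a, ha1, ha0, ha, hL⟩ := h
  have key : ∀ i, IsHomog 𝒜 (m + 1 + i : ℕ) (superD δ (a i) - η * a i) := by
    intro i
    have h2 := (isHomog_one_iff.2 hη).mul (ha i)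
    have h1 := (ha i).superD δ
    rw [add_comm 1] at h2
    rw [add_right_comm, Nat.cast_succ]
    exact h1.sub h2
  -- These are the coefficients of `(𝒟 - η) ∑ a_i 𝒟^i`, since `𝒟 ∘ a_i = (𝒟 a_i) + invol (a_i) 𝒟`.
  -- As `a` vanishes beyond `m`, one formula covers all `i`.
  refine ⟨fun i => superD δ (a i) - η * a i + match i with
    | 0 => 0
    | i + 1 => invol (a i), ?_, ?_, ?_, ?_⟩
  · dsimp only
    rw [ha1, ha0 _ (Nat.lt_succ_self m), superD_zero, mul_zero, sub_zero, zero_add,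
      invol_of_bosonic (one_mem _)]
  · rintro (_ | i) hi
    · omega
    · dsimp only
      rw [ha0 (i + 1) (by omega), ha0 i (by omega), superD_zero, mul_zero, sub_zero, zero_add,
        invol_of_bosonic (zero_mem _)]
  · rintro (_ | i)
    · exact (key 0).add IsHomog.zero
    · refine (key (i + 1)).add ?_
      have := (ha i).invol
      rwa [show ((m + 1 + (i + 1) : ℕ) : ZMod 2) = (m + i : ℕ) by
        push_cast
        rw [show (m + 1 + (i + 1) : ZMod 2) = m + i + (1 + 1) by ring, zmod_two_add_self,
          add_zero]]
  · intro f
    dsimp only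
    rw [hg, hL, superD_sum, Finset.mul_sum, ← Finset.sum_sub_distrib]
    simp only [add_mul, Finset.sum_add_distrib]
    rw [Finset.sum_range_succ (fun i => (superD δ (a i) - η * a i) * _),
      ha0 _ (Nat.lt_succ_self m), superD_zero, mul_zero, sub_zero, zero_mul, add_zero,
      Finset.sum_range_succ' _ (m + 1), zero_mul, add_zero, ← Finset.sum_add_distrib]
    refine Finset.sum_congr rfl fun i _ => ?_
    rw [superD_mul, Function.iterate_succ_apply', sub_mul, mul_assoc]
    abel

omit [IsSupercommutative 𝒜] in
theorem isMonicOperator_id : IsMonicOperator δ 0 fun f => f := by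
  refine ⟨fun i => if i = 0 then 1 else 0, rfl, fun i hi => if_neg hi.ne', fun i => ?_,
    fun f => by simp⟩
  rcases i with _ | i
  · simpa using isHomog_one
  · exact IsHomog.zero

theorem sum_range_even_odd {B : Type*} [AddCommMonoid B] (u : ℕ → B) (n : ℕ) :
    ∑ i ∈ Finset.range (2 * n), u i =
      ∑ i : Fin n, u (2 * i) + ∑ i : Fin n, u (2 * i + 1) := by
  induction n with
  | zero => simp
  | succ n ih =>
    rw [mul_add, mul_one, Finset.sum_range_succ, Finset.sum_range_succ, ih,
      Fin.sum_univ_castSucc, Fin.sum_univ_castSucc]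
    simp only [Fin.val_castSucc, Fin.val_last]
    abel

theorem cast_two_mul_add (n i : ℕ) : ((2 * n + 2 * i : ℕ) : ZMod 2) = 0 := by
  rw [← mul_add, Nat.cast_mul]
  exact zero_mul _

omit [IsSupercommutative 𝒜] in
-- The coefficient of `𝒟^i` has parity `m + i`. For even `m` the bosonic ones thus belong to the
-- even powers `𝒟^{2i} = ∂^i`, including the leading one.
theorem IsMonicOperator.exists_even {n : ℕ} {L : Superfield 𝒜 → Superfield 𝒜}
    (h : IsMonicOperator δ (2 * n) L) :
    ∃ (c : Fin n → bosonic 𝒜) (γ : Fin n → Superfield 𝒜), ∀ f, L f = (dx δ)^[n] f +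
      ∑ i, (c i : Superfield 𝒜) * (dx δ)^[i] f + ∑ i, γ i * (dx δ)^[i] (superD δ f) := by
  obtain ⟨a, ha1, -, ha, hL⟩ := h
  refine ⟨fun i => ⟨a (2 * i), isHomog_zero_iff.1 ?_⟩, fun i => a (2 * i + 1), fun f => ?_⟩
  · have := ha (2 * i)
    rwa [cast_two_mul_add] at this
  · rw [hL, Finset.sum_range_succ, ha1, one_mul, sum_range_even_odd, add_comm, ← add_assoc]
    simp only [Function.iterate_succ_apply, superD_iterate_two_mul]

omit [IsSupercommutative 𝒜] in
-- For odd `m` the bosonic coefficients belong to the odd powers `∂^i 𝒟`, which is why the blocks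
-- `P` and `S` change roles.
theorem IsMonicOperator.exists_odd {n : ℕ} {L : Superfield 𝒜 → Superfield 𝒜}
    (h : IsMonicOperator δ (2 * n + 1) L) :
    ∃ (c : Fin n → bosonic 𝒜) (γ : Fin (n + 1) → Superfield 𝒜), ∀ f, L f =
      (dx δ)^[n] (superD δ f) + ∑ i, (c i : Superfield 𝒜) * (dx δ)^[i] (superD δ f) +
      ∑ i, γ i * (dx δ)^[i] f := by
  obtain ⟨a, ha1, -, ha, hL⟩ := h
  refine ⟨fun i => ⟨a (2 * i + 1), isHomog_zero_iff.1 ?_⟩, fun i => a (2 * i), fun f => ?_⟩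
  · have := ha (2 * i + 1)
    rwa [show 2 * n + 1 + (2 * (i : ℕ) + 1) = 2 * (n + 1) + 2 * i by ring,
      cast_two_mul_add] at this
  · rw [hL, show 2 * n + 1 + 1 = 2 * (n + 1) by ring, sum_range_even_odd,
      Fin.sum_univ_castSucc (fun i : Fin (n + 1) => a (2 * i + 1) * _), Fin.val_last, ha1, one_mul]
    simp only [Function.iterate_succ_apply, superD_iterate_two_mul, Fin.val_castSucc]
    abel

end Operators

/-! ### The Darboux chain and Wronskian-type Berezinians. -/

section Wronskian

variable {𝕜 A : Type*} [Field 𝕜] [Ring A] [Algebra 𝕜 A]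
variable {𝒜 : ZMod 2 → Submodule 𝕜 A} [GradedAlgebra 𝒜] [IsSupercommutative 𝒜]
variable {δ : EvenDerivation 𝒜}

omit [IsSupercommutative 𝒜] in
theorem interlace_two_mul (b : ℕ → bosonic 𝒜) (o : ℕ → fermionic 𝒜) (i : ℕ) :
    interlace b o (2 * i) = b i := by
  simp [interlace]

omit [IsSupercommutative 𝒜] in
theorem interlace_two_mul_add_one (b : ℕ → bosonic 𝒜) (o : ℕ → fermionic 𝒜) (i : ℕ) :
    interlace b o (2 * i + 1) = o i := by
  rw [interlace, if_neg (Nat.not_even_two_mul_add_one i), show (2 * i + 1) / 2 = i by omega]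

omit [IsSupercommutative 𝒜] in
theorem isHomog_interlace (b : ℕ → bosonic 𝒜) (o : ℕ → fermionic 𝒜) (j : ℕ) :
    IsHomog 𝒜 j (interlace b o j) := by
  obtain ⟨i, rfl | rfl⟩ := Nat.even_or_odd' j
  · rw [interlace_two_mul, show 2 * i = 2 * 0 + 2 * i by ring, cast_two_mul_add]
    exact isHomog_zero_iff.2 (b i).2
  · rw [interlace_two_mul_add_one, Nat.cast_succ, show 2 * i = 2 * 0 + 2 * i by ring,
      cast_two_mul_add, zero_add]
    exact isHomog_one_iff.2 (o i).2

theorem isMonicOperator_iterGauge [CharZero 𝕜] {φ : ℕ → Superfield 𝒜}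
    (hφ : ∀ j, IsHomog 𝒜 (j : ℕ) (φ j)) (m : ℕ)
    (hu : ∀ j < m, IsUnit (iterGauge δ φ j (φ j))) :
    IsMonicOperator δ m (iterGauge δ φ m) := by
  induction m with
  | zero => exact isMonicOperator_id
  | succ m ih =>
    have h := ih fun j hj => hu j (by omega)
    -- Operator and argument both have parity `m`, so `χ_m` is bosonic.
    have hχ := h.isHomog (hφ m)
    rw [zmod_two_add_self] at hχ
    exact h.gauge_comp (isHomog_zero_iff.1 hχ) (hu m (Nat.lt_succ_self m))

omit [IsSupercommutative 𝒜] in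
-- The factor with index `j` sends `χ_j` to `χ_j 𝒟 1 = 0`, and the later factors fix `0`.
theorem iterGauge_apply_eq_zero {φ : ℕ → Superfield 𝒜} (m : ℕ)
    (hu : ∀ j < m, IsUnit (iterGauge δ φ j (φ j))) (j : ℕ) (hj : j < m) :
    iterGauge δ φ m (φ j) = 0 := by
  induction m with
  | zero => omega
  | succ m ih =>
    rw [iterGauge, gauge]
    obtain h | rfl := Nat.lt_succ_iff_lt_or_eq.1 hj
    · rw [ih (fun i hi => hu i (by omega)) h, mul_zero, superD_zero, mul_zero]
    · rw [Ring.inverse_mul_cancel _ (hu j hj), superD_one, mul_zero]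

omit [IsSupercommutative 𝒜] in
theorem coe_wronskianMatrix_dxB {k l : ℕ} (b : Fin l → bosonic 𝒜) (i : Fin k) (j : Fin l) :
    ((wronskianMatrix (dxB δ) k b i j : bosonic 𝒜) : Superfield 𝒜) = (dx δ)^[i] (b j) :=
  coe_dxB_iterate δ i (b j)

omit [IsSupercommutative 𝒜] in
theorem coe_wronskianMatrix_dxF {k l : ℕ} (o : Fin l → fermionic 𝒜) (i : Fin k) (j : Fin l) :
    ((wronskianMatrix (dxF δ) k o i j : fermionic 𝒜) : Superfield 𝒜) = (dx δ)^[i] (o j) :=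
  coe_dxF_iterate δ i (o j)

omit [IsSupercommutative 𝒜] in
theorem coe_superDB (f : bosonic 𝒜) : (superDB δ f : Superfield 𝒜) = superD δ f := rfl

omit [IsSupercommutative 𝒜] in
theorem coe_superDF (f : fermionic 𝒜) : (superDF δ f : Superfield 𝒜) = superD δ f := rfl

theorem firstNSnoc_castSucc {E : Type*} (f : ℕ → E) (n : ℕ) (x : E) (j : Fin n) :
    firstNSnoc f n x j.castSucc = firstN f n j := by
  simp [firstNSnoc]

theorem firstNSnoc_last {E : Type*} (f : ℕ → E) (n : ℕ) (x : E) :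
    firstNSnoc f n x (Fin.last n) = x := by
  simp [firstNSnoc]

theorem firstNSnoc_self {E : Type*} (f : ℕ → E) (n : ℕ) :
    firstNSnoc f n (f n) = firstN f (n + 1) := by
  funext j
  refine Fin.lastCases ?_ (fun i => ?_) j
  · rw [firstNSnoc_last]; rfl
  · rw [firstNSnoc_castSucc]; rfl

theorem wronskianMatrix_firstNSnoc_submatrix {E G : Type*} (d : G → G) (g : E → G) {k k' n : ℕ}
    (f : ℕ → E) (x : E) (e : Fin k' → Fin k) (he : ∀ i, (e i : ℕ) = i) :
    (wronskianMatrix d k fun j => g (firstNSnoc f n x j)).submatrix e Fin.castSucc =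
      wronskianMatrix d k' fun j => g (firstN f n j) := by
  ext1 i j
  simp only [wronskianMatrix, Matrix.submatrix_apply, Matrix.of_apply, firstNSnoc_castSucc, he]

/-- The coefficients of `L` are the row operation: a column attached to `f` has entries `∂^i f`
above and `∂^i 𝒟 f` below, so the combination gives `L f`, which is `0` except in the column of `Φ`.
-/
theorem wronskianBer_firstNSnoc {n : ℕ} {L : Superfield 𝒜 → Superfield 𝒜}
    (hL : IsMonicOperator δ (2 * n) L) (b : ℕ → bosonic 𝒜) (o : ℕ → fermionic 𝒜)
    (hb : ∀ i < n, L (b i) = 0) (ho : ∀ i < n, L (o i) = 0) {Φ t : bosonic 𝒜}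
    (ht : (t : Superfield 𝒜) = L Φ)
    (hS : WronskianBerDefined δ (firstN b n) (firstN o n)) :
    wronskianBer δ (firstNSnoc b n Φ) (firstN o n) =
      t * wronskianBer δ (firstN b n) (firstN o n) := by
  obtain ⟨c, γ, hcγ⟩ := hL.exists_even
  rw [wronskianBer, wronskianBer, ber, ber, ← mul_assoc]
  congr 1
  rw [det_schur_succ _ _ _ _ ((Matrix.isUnit_iff_isUnit_det _).1 hS) c γ t]
  · congr 3
    · exact wronskianMatrix_firstNSnoc_submatrix (dxB δ) id b Φ _ fun _ => rfl
    · exact wronskianMatrix_firstNSnoc_submatrix (dxF δ) (superDB δ) b Φ id fun _ => rfl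
  · intro j
    simp only [coe_wronskianMatrix_dxB, coe_wronskianMatrix_dxF, coe_superDB, Fin.val_last,
      Fin.val_castSucc]
    rw [← hcγ]
    refine Fin.lastCases ?_ (fun i => ?_) j
    · rw [firstNSnoc_last, if_pos rfl, ht]
    · rw [firstNSnoc_castSucc, if_neg (Fin.castSucc_lt_last i).ne]
      exact hb i i.2
  · intro j
    simp only [coe_wronskianMatrix_dxB, coe_wronskianMatrix_dxF, coe_superDF, Fin.val_last,
      Fin.val_castSucc]
    rw [← hcγ]
    exact ho j j.2

/-- The same row operation with the diagonal blocks exchanged: the rows carrying `𝒟` now supply the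
leading term `∂^n 𝒟` of `L`. -/
theorem wronskianBerInv_firstNSnoc {n : ℕ} {L : Superfield 𝒜 → Superfield 𝒜}
    (hL : IsMonicOperator δ (2 * n + 1) L) (b : ℕ → bosonic 𝒜) (o : ℕ → fermionic 𝒜)
    (hb : ∀ i < n + 1, L (b i) = 0) (ho : ∀ i < n, L (o i) = 0) {F : fermionic 𝒜} {t : bosonic 𝒜}
    (ht : (t : Superfield 𝒜) = L F)
    (hP : WronskianBerInvDefined δ (firstN b (n + 1)) (firstN o n)) :
    wronskianBerInv δ (firstN b (n + 1)) (firstNSnoc o n F) =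
      t * wronskianBerInv δ (firstN b (n + 1)) (firstN o n) := by
  obtain ⟨c, γ, hcγ⟩ := hL.exists_odd
  rw [wronskianBerInv, wronskianBerInv, berInv, berInv, ← mul_assoc]
  congr 1
  rw [det_schur_succ _ _ _ _ ((Matrix.isUnit_iff_isUnit_det _).1 hP) c γ t]
  · congr 3
    · exact wronskianMatrix_firstNSnoc_submatrix (dxB δ) (superDF δ) o F _ fun _ => rfl
    · exact wronskianMatrix_firstNSnoc_submatrix (dxF δ) id o F id fun _ => rfl
  · intro j
    simp only [coe_wronskianMatrix_dxB, coe_wronskianMatrix_dxF, coe_superDF, Fin.val_last,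
      Fin.val_castSucc]
    rw [← hcγ]
    refine Fin.lastCases ?_ (fun i => ?_) j
    · rw [firstNSnoc_last, if_pos rfl, ht]
    · rw [firstNSnoc_castSucc, if_neg (Fin.castSucc_lt_last i).ne]
      exact ho i i.2
  · intro j
    simp only [coe_wronskianMatrix_dxB, coe_wronskianMatrix_dxF, coe_superDB, Fin.val_last,
      Fin.val_castSucc]
    rw [← hcγ]
    exact hb j j.2

/-! ### Transfer of invertibility between the Berezinian and its two diagonal blocks. -/

section Invertibility

variable [CharZero 𝕜] {k l : ℕ} {b : Fin k → bosonic 𝒜} {o : Fin l → fermionic 𝒜}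

theorem wronskianBer_mul_wronskianBerInv (hP : WronskianBerInvDefined δ b o)
    (hS : WronskianBerDefined δ b o) : wronskianBer δ b o * wronskianBerInv δ b o = 1 :=
  ber_mul_berInv _ _ ((Matrix.isUnit_iff_isUnit_det _).1 hP)
    ((Matrix.isUnit_iff_isUnit_det _).1 hS)

theorem wronskianBerInvDefined_of_isUnit (h : IsUnit (wronskianBer δ b o)) :
    WronskianBerInvDefined δ b o :=
  (Matrix.isUnit_iff_isUnit_det _).2
    (isUnit_det_of_isUnit_det_schur (isUnit_of_mul_isUnit_left h))

theorem wronskianBerDefined_of_isUnit (h : IsUnit (wronskianBerInv δ b o)) :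
    WronskianBerDefined δ b o :=
  (Matrix.isUnit_iff_isUnit_det _).2
    (isUnit_det_of_isUnit_det_schur (isUnit_of_mul_isUnit_left h))

end Invertibility

/-! ### Induction along the chain of gauge factors. -/

section Chain

variable [CharZero 𝕜] (b : ℕ → bosonic 𝒜) (o : ℕ → fermionic 𝒜) (n : ℕ)

theorem wronskianBer_firstNSnoc_eq_iterGauge
    (hu : ∀ j < 2 * n, IsUnit (iterGauge δ (interlace b o) j (interlace b o j)))
    (hS : WronskianBerDefined δ (firstN b n) (firstN o n)) (Φ : bosonic 𝒜) :
    ∃ t : bosonic 𝒜, (t : Superfield 𝒜) = iterGauge δ (interlace b o) (2 * n) Φ ∧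
      wronskianBer δ (firstNSnoc b n Φ) (firstN o n) =
        t * wronskianBer δ (firstN b n) (firstN o n) := by
  have hL := isMonicOperator_iterGauge (isHomog_interlace b o) _ hu
  have hΦ := hL.isHomog (isHomog_zero_iff.2 Φ.2)
  rw [show 2 * n = 2 * n + 2 * 0 by ring, cast_two_mul_add, add_zero] at hΦ
  refine ⟨⟨_, isHomog_zero_iff.1 hΦ⟩, rfl, wronskianBer_firstNSnoc hL b o ?_ ?_ rfl hS⟩
  · intro i hi
    rw [← interlace_two_mul b o i]
    exact iterGauge_apply_eq_zero _ hu _ (by omega)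
  · intro i hi
    rw [← interlace_two_mul_add_one b o i]
    exact iterGauge_apply_eq_zero _ hu _ (by omega)

theorem wronskianBerInv_firstNSnoc_eq_iterGauge
    (hu : ∀ j < 2 * n + 1, IsUnit (iterGauge δ (interlace b o) j (interlace b o j)))
    (hP : WronskianBerInvDefined δ (firstN b (n + 1)) (firstN o n)) (F : fermionic 𝒜) :
    ∃ t : bosonic 𝒜, (t : Superfield 𝒜) = iterGauge δ (interlace b o) (2 * n + 1) F ∧
      wronskianBerInv δ (firstN b (n + 1)) (firstNSnoc o n F) =
        t * wronskianBerInv δ (firstN b (n + 1)) (firstN o n) := by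
  have hL := isMonicOperator_iterGauge (isHomog_interlace b o) _ hu
  have hF := hL.isHomog (isHomog_one_iff.2 F.2)
  rw [← Nat.cast_succ, show (2 * n + 1).succ = 2 * n + 2 * 1 by omega, cast_two_mul_add] at hF
  refine ⟨⟨_, isHomog_zero_iff.1 hF⟩, rfl, wronskianBerInv_firstNSnoc hL b o ?_ ?_ rfl hP⟩
  · intro i hi
    rw [← interlace_two_mul b o i]
    exact iterGauge_apply_eq_zero _ hu _ (by omega)
  · intro i hi
    rw [← interlace_two_mul_add_one b o i]
    exact iterGauge_apply_eq_zero _ hu _ (by omega)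

/-- Taking `Φ = φ_n` makes the new factor equal to `χ_{2n}`. -/
theorem isUnit_wronskianBer_succ
    (hu : ∀ j < 2 * n + 1, IsUnit (iterGauge δ (interlace b o) j (interlace b o j)))
    (hS : WronskianBerDefined δ (firstN b n) (firstN o n))
    (hB : IsUnit (wronskianBer δ (firstN b n) (firstN o n))) :
    IsUnit (wronskianBer δ (firstN b (n + 1)) (firstN o n)) := by
  obtain ⟨t, ht, h⟩ := wronskianBer_firstNSnoc_eq_iterGauge b o n
    (fun j hj => hu j (by omega)) hS (b n)
  rw [← firstNSnoc_self, h]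
  refine IsUnit.mul (isUnit_bosonic_iff.2 ?_) hB
  rw [ht, ← interlace_two_mul b o n]
  exact hu (2 * n) (by omega)

theorem wronskianBer_isUnit_of_even
    (hu : ∀ j < 2 * n, IsUnit (iterGauge δ (interlace b o) j (interlace b o j))) :
    WronskianBerDefined δ (firstN b n) (firstN o n) ∧
      IsUnit (wronskianBer δ (firstN b n) (firstN o n)) := by
  induction n with
  | zero =>
    refine ⟨(Matrix.isUnit_iff_isUnit_det _).2 ?_, ?_⟩
    · rw [Matrix.det_isEmpty]; exact isUnit_one
    · rw [wronskianBer, ber, Matrix.det_isEmpty, Matrix.det_isEmpty, Ring.inverse_one, mul_one]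
      exact isUnit_one
  | succ n ih =>
    obtain ⟨hS, hB⟩ := ih fun j hj => hu j (by omega)
    have hu' : ∀ j < 2 * n + 1, IsUnit (iterGauge δ (interlace b o) j (interlace b o j)) :=
      fun j hj => hu j (by omega)
    have hB' := isUnit_wronskianBer_succ b o n hu' hS hB
    -- Adding a fermionic superfield enlarges `S`, about which nothing is known yet. The induction
    -- therefore switches to `Ber⁻¹`, which needs only `P`, multiplies it by `χ_{2n+1}`, and reads
    -- off the invertibility of the new `S`.
    have hP := wronskianBerInvDefined_of_isUnit hB'
    have hI := IsUnit.of_mul_eq_one _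
      ((mul_comm _ _).trans (wronskianBer_mul_wronskianBerInv hP hS))
    obtain ⟨t, ht, h⟩ := wronskianBerInv_firstNSnoc_eq_iterGauge b o n hu' hP (o n)
    have hI' : IsUnit (wronskianBerInv δ (firstN b (n + 1)) (firstN o (n + 1))) := by
      rw [← firstNSnoc_self o, h]
      refine IsUnit.mul (isUnit_bosonic_iff.2 ?_) hI
      rw [ht, ← interlace_two_mul_add_one b o n]
      exact hu (2 * n + 1) (by omega)
    have hS' := wronskianBerDefined_of_isUnit hI'
    exact ⟨hS', IsUnit.of_mul_eq_one _ (wronskianBer_mul_wronskianBerInv hP hS')⟩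

end Chain

end Wronskian

end Superfield

theorem proposition2 {𝕜 A : Type*} [Field 𝕜] [CharZero 𝕜] [Ring A] [Algebra 𝕜 A]
    (𝒜 : ZMod 2 → Submodule 𝕜 A) [GradedAlgebra 𝒜] [IsSupercommutative 𝒜]
    (δ : EvenDerivation 𝒜) (b : ℕ → bosonic 𝒜) (o : ℕ → fermionic 𝒜) (n : ℕ) :
    -- an even number of steps, applied to an arbitrary bosonic superfield `Φ`
    ((∀ j < 2 * n, IsUnit (iterGauge δ (interlace b o) j (interlace b o j))) →
      ∀ Φ : bosonic 𝒜,
        WronskianBerDefined δ (firstN b n) (firstN o n) ∧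
        IsUnit (wronskianBer δ (firstN b n) (firstN o n)) ∧
        WronskianBerDefined δ (firstNSnoc b n Φ) (firstN o n) ∧
        iterGauge δ (interlace b o) (2 * n) (Φ : Superfield 𝒜) =
          ((Ring.inverse (wronskianBer δ (firstN b n) (firstN o n)) *
            wronskianBer δ (firstNSnoc b n Φ) (firstN o n) : bosonic 𝒜) : Superfield 𝒜)) ∧
    -- an odd number of steps, applied to an arbitrary fermionic superfield `F`
    ((∀ j < 2 * n + 1, IsUnit (iterGauge δ (interlace b o) j (interlace b o j))) →
      ∀ F : fermionic 𝒜,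
        WronskianBerDefined δ (firstN b (n + 1)) (firstN o n) ∧
        IsUnit (wronskianBer δ (firstN b (n + 1)) (firstN o n)) ∧
        WronskianBerInvDefined δ (firstN b (n + 1)) (firstNSnoc o n F) ∧
        iterGauge δ (interlace b o) (2 * n + 1) (F : Superfield 𝒜) =
          ((wronskianBer δ (firstN b (n + 1)) (firstN o n) *
            wronskianBerInv δ (firstN b (n + 1)) (firstNSnoc o n F) : bosonic 𝒜) :
              Superfield 𝒜) ∧
        -- and, whenever `Ber_{(n+1,n+1)}` itself is defined, with its inverse taken literally
        (WronskianBerDefined δ (firstN b (n + 1)) (firstNSnoc o n F) →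
          IsUnit (wronskianBer δ (firstN b (n + 1)) (firstNSnoc o n F)) ∧
          iterGauge δ (interlace b o) (2 * n + 1) (F : Superfield 𝒜) =
            ((wronskianBer δ (firstN b (n + 1)) (firstN o n) *
              Ring.inverse (wronskianBer δ (firstN b (n + 1)) (firstNSnoc o n F)) :
                bosonic 𝒜) : Superfield 𝒜))) := by
  refine ⟨fun hu Φ => ?_, fun hu F => ?_⟩
  · obtain ⟨hS, hB⟩ := wronskianBer_isUnit_of_even b o n hu
    obtain ⟨t, ht, h⟩ := wronskianBer_firstNSnoc_eq_iterGauge b o n hu hS Φ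
    -- The block `S` involves only the fermionic superfields, so `hS` also serves after `Φ` is
    -- appended.
    refine ⟨hS, hB, hS, ?_⟩
    rw [h, mul_comm t, ← mul_assoc, Ring.inverse_mul_cancel _ hB, one_mul, ht]
  · have hu' : ∀ j < 2 * n, IsUnit (iterGauge δ (interlace b o) j (interlace b o j)) :=
      fun j hj => hu j (by omega)
    obtain ⟨hS, hB⟩ := wronskianBer_isUnit_of_even b o n hu'
    have hB' := isUnit_wronskianBer_succ b o n hu hS hB
    have hP : WronskianBerInvDefined δ (firstN b (n + 1)) (firstN o n) :=
      wronskianBerInvDefined_of_isUnit hB'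
    obtain ⟨t, ht, h⟩ := wronskianBerInv_firstNSnoc_eq_iterGauge b o n hu hP F
    have key : iterGauge δ (interlace b o) (2 * n + 1) (F : Superfield 𝒜) =
        ((wronskianBer δ (firstN b (n + 1)) (firstN o n) *
          wronskianBerInv δ (firstN b (n + 1)) (firstNSnoc o n F) : bosonic 𝒜) :
            Superfield 𝒜) := by
      -- `Ber_{(n+1,n)}` cancels against its own inverse expression, leaving `L F`; `hS` applies
      -- because `S` does not involve `φ_n`.
      rw [h, mul_left_comm, wronskianBer_mul_wronskianBerInv hP hS, mul_one, ht]
    refine ⟨hS, hB', hP, key, fun hSF => ?_⟩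
    have hone := wronskianBer_mul_wronskianBerInv
      (b := firstN b (n + 1)) (o := firstNSnoc o n F) hP hSF
    have hU := IsUnit.of_mul_eq_one _ hone
    refine ⟨hU, ?_⟩
    rw [key, left_inv_eq_right_inv (Ring.inverse_mul_cancel _ hU) hone]
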